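/- Let $M$ be a $C^\infty$ surface without boundary, let $X,Y$ be $C^\infty$ vector fields on $M$, and suppose that $Y$ tracks $X$ with tracking function $f$, i.e. $f\colon M\to\mathbb R$ is continuous and $[Y,X]=fX$. Let $Z(X)$ and $Z(Y)$ denote the sets of zeros of $X$ and $Y$. For an integer $n\ge 1$ let $Z_n(X)$ be the set of zeros $p$ of $X$ of order $n$, that is, those where the $(n-1)$-jet of $X$ at $p$ vanishes but the $n$-jet does not; let $Z_\infty(X)$ be the set of points at which all jets of $X$ vanish. Then: 1. For each $n\in\{1,2,3,\dots\}\cup\{\infty\}$ the set $Z_n(X)$ is $Y$-invariant, i.e. it contains the orbit under $Y$ (the trace of the maximal integral curve) of each of its points. 2. The set $[M\setminus Z(X)]\cup[(Z(X)\setminus Z_\infty(X))\cap(M\setminus Z(Y))]$ is open in $M$, and $f$ is differentiable, in the sense of $C^\infty$, on it. -/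

import Mathlib

open scoped Manifold ContDiff

/-- `X` is a `C^∞` vector field on the `m`-dimensional manifold without boundary `M`. -/
def IsSmoothVectorField {m : ℕ} {M : Type*} [TopologicalSpace M]
    [ChartedSpace (EuclideanSpace ℝ (Fin m)) M] [IsManifold (𝓡 m) ∞ M]
    (X : (x : M) → TangentSpace (𝓡 m) x) : Prop :=
  ContMDiff (𝓡 m) (𝓡 m).tangent ∞ (fun x => (⟨x, X x⟩ : TangentBundle (𝓡 m) M))

/-- The continuous function `f` is a tracking function for `Y` and `X`: `[Y, X] = f X`. -/
def IsTrackingFunction {m : ℕ} {M : Type*} [TopologicalSpace M]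
    [ChartedSpace (EuclideanSpace ℝ (Fin m)) M]
    (Y X : (x : M) → TangentSpace (𝓡 m) x) (f : M → ℝ) : Prop :=
  Continuous f ∧ ∀ x, VectorField.mlieBracket (𝓡 m) Y X x = f x • X x

/-- The set of zeros of a vector field. -/
def zeroSet {m : ℕ} {M : Type*} [TopologicalSpace M]
    [ChartedSpace (EuclideanSpace ℝ (Fin m)) M]
    (X : (x : M) → TangentSpace (𝓡 m) x) : Set M :=
  {p | X p = 0}

/-- The expression of the vector field `X` in the chart at `p`, a map `ℝ^m → ℝ^m` that is
meaningful on the target of this chart. -/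
noncomputable def coordRep {m : ℕ} {M : Type*} [TopologicalSpace M]
    [ChartedSpace (EuclideanSpace ℝ (Fin m)) M]
    (X : (x : M) → TangentSpace (𝓡 m) x) (p : M) :
    EuclideanSpace ℝ (Fin m) → EuclideanSpace ℝ (Fin m) :=
  VectorField.mpullback 𝓘(ℝ, EuclideanSpace ℝ (Fin m)) (𝓡 m) (extChartAt (𝓡 m) p).symm X

/-- `j_p^n X = 0`: all the derivatives at `p` of order at most `n` of the components of `X` in
the chart at `p` vanish. (For smooth `X` this does not depend on the chart about `p`.) -/
def JetVanishes {m : ℕ} {M : Type*} [TopologicalSpace M]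
    [ChartedSpace (EuclideanSpace ℝ (Fin m)) M]
    (X : (x : M) → TangentSpace (𝓡 m) x) (n : ℕ) (p : M) : Prop :=
  ∀ k ≤ n, iteratedFDeriv ℝ k (coordRep X p) (extChartAt (𝓡 m) p p) = 0

/-- The order of `X` at `p`: the least `n` with `j_p^n X ≠ 0`, and `∞` if all the jets of `X`
at `p` vanish. -/
noncomputable def vectorFieldOrder {m : ℕ} {M : Type*} [TopologicalSpace M]
    [ChartedSpace (EuclideanSpace ℝ (Fin m)) M]
    (X : (x : M) → TangentSpace (𝓡 m) x) (p : M) : ℕ∞ :=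
  ⨅ (n : ℕ) (_ : ¬ JetVanishes X n p), (n : ℕ∞)

/-- The set of zeros of order `n` of a vector field. -/
def zerosOfOrder {m : ℕ} {M : Type*} [TopologicalSpace M]
    [ChartedSpace (EuclideanSpace ℝ (Fin m)) M]
    (X : (x : M) → TangentSpace (𝓡 m) x) (n : ℕ∞) : Set M :=
  {p | p ∈ zeroSet X ∧ vectorFieldOrder X p = n}

/-- The orbit of `p` under the vector field `V`: all points reached from `p` along integral
curves of `V` that are defined on open intervals containing `0`. -/
def orbitOf {m : ℕ} {M : Type*} [TopologicalSpace M]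
    [ChartedSpace (EuclideanSpace ℝ (Fin m)) M]
    (V : (x : M) → TangentSpace (𝓡 m) x) (p : M) : Set M :=
  {q | ∃ (γ : ℝ → M) (J : Set ℝ), IsOpen J ∧ J.OrdConnected ∧ (0 : ℝ) ∈ J ∧
    IsMIntegralCurveOn γ V J ∧ γ 0 = p ∧ ∃ t ∈ J, γ t = q}

/-- A set is `V`-invariant if it contains the orbits under `V` of its points. -/
def IsInvariantUnder {m : ℕ} {M : Type*} [TopologicalSpace M]
    [ChartedSpace (EuclideanSpace ℝ (Fin m)) M]
    (V : (x : M) → TangentSpace (𝓡 m) x) (S : Set M) : Prop :=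
  ∀ p ∈ S, orbitOf V p ⊆ S

/-!
Both parts rest on replacing jets by growth: the `n`-jet of a smooth map `g` vanishes at `x` iff
`g y = O(‖y - x‖ ^ (n + 1))` (`ContDiffAt.iteratedFDeriv_eq_zero_iff_isBigO`). In particular the
order of a vector field at `x` can be read off in any chart around `x`.

*Invariance.* In a chart, `[Y, X] = f X` reads `DX Y = DY X + f X`, so along every integral curve
`c` of `Y` the function `X ∘ c` solves a linear equation with bounded coefficients. By Grönwall's
inequality the size of `X` at the two ends of a short trajectory is comparable, and so is the
distance between two trajectories at their two ends. Hence the growth of `X` at `c t` does not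
depend on `t` (`eventually_isBigO_pow_iff_of_integralCurve`); only continuity of `f` is used, and no
differentiability of the flow. Connectedness of the time interval makes this global.

*Regularity.* Where `X ≠ 0`, `f` is the quotient of a component of `[Y, X]` by one of `X`. At a
zero `p` of finite order `n` of `X` with `Y p ≠ 0`, let `ℓ` be a smooth defining function of the
integral curve of `Y` through `p`. By invariance `X` vanishes to order `n` along this curve, so
that `X = ℓ ^ n W` with `W` smooth by Hadamard's lemma, and `W p ≠ 0` because the order at `p` is
exactly `n`. As `Y` is tangent to the curve, `Y ℓ = ℓ b` with `b` smooth. Then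
`[Y, X] = ℓ ^ n ([Y, W] + n b W)`, and cancelling `ℓ ^ n` leaves `f W = [Y, W] + n b W`, which
exhibits `f` as a quotient of smooth functions
(`contDiffAt_of_bracket_eq_smul_of_finite_order`).
-/

open Filter Topology Asymptotics

/-! ### Jets and growth -/

/-- Iterated derivatives are invariant under adjacent transpositions of their arguments. The swap
of the two outermost derivatives is the symmetry of the second derivative of `D ^ (k - 1) g`; all
other swaps act inside the outermost derivative, so induction applies. -/
theorem ContDiffAt.iteratedFDeriv_comp_swap {E F : Type*} [NormedAddCommGroup E]
    [NormedSpace ℝ E] [NormedAddCommGroup F] [NormedSpace ℝ F] {g : E → F} {k : ℕ} :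
    ∀ {x : E}, ContDiffAt ℝ (k + 1) g x → ∀ (i : Fin k) (v : Fin (k + 1) → E),
    iteratedFDeriv ℝ (k + 1) g x (v ∘ Equiv.swap i.castSucc i.succ) =
      iteratedFDeriv ℝ (k + 1) g x v := by
  induction k with
  | zero => exact fun _ i => i.elim0
  | succ k ih =>
    intro x hg i v
    cases i using Fin.cases with
    | succ i =>
      have hd : DifferentiableAt ℝ (iteratedFDeriv ℝ (k + 1) g) x :=
        hg.differentiableAt_iteratedFDeriv (by norm_cast; omega)
      rw [hd.iteratedFDeriv_succ_apply_left', hd.iteratedFDeriv_succ_apply_left']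
      have h0 : (v ∘ Equiv.swap i.succ.castSucc i.succ.succ) 0 = v 0 := by
        rw [Function.comp_apply, Equiv.swap_apply_of_ne_of_ne] <;>
        simp [Fin.ext_iff]
      have htail : Fin.tail (v ∘ Equiv.swap i.succ.castSucc i.succ.succ) =
          Fin.tail v ∘ Equiv.swap i.castSucc i.succ := by
        ext j
        simp only [Fin.tail, Function.comp_apply, Fin.castSucc_succ]
        congr 1
        exact ((Fin.succ_injective _).swap_apply _ _ _)
      rw [h0, htail]
      congr 1
      refine Filter.EventuallyEq.fderiv_eq ?_
      filter_upwards [hg.eventually (by simp)] with z hz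
      exact ih (hz.of_le (by norm_cast; omega)) i _
    | zero =>
      have h2 : ContDiffAt ℝ 2 (iteratedFDeriv ℝ k g) x :=
        hg.iteratedFDeriv_right (by norm_cast; omega)
      have h1 : DifferentiableAt ℝ (fderiv ℝ (iteratedFDeriv ℝ k g)) x :=
        (h2.fderiv_right (m := 1) (by norm_num)).differentiableAt (by norm_num)
      have hd : DifferentiableAt ℝ (iteratedFDeriv ℝ (k + 1) g) x :=
        hg.differentiableAt_iteratedFDeriv (by norm_cast; omega)
      have key : ∀ w : Fin (k + 2) → E, iteratedFDeriv ℝ (k + 2) g x w =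
          fderiv ℝ (fderiv ℝ (iteratedFDeriv ℝ k g)) x (w 0) (w 1) (Fin.tail (Fin.tail w)) := by
        intro w
        rw [hd.iteratedFDeriv_succ_apply_left']
        change fderiv ℝ (fun y => fderiv ℝ (iteratedFDeriv ℝ k g) y (w 1) (Fin.tail (Fin.tail w)))
          x (w 0) = _
        rw [fderiv_continuousMultilinear_apply_const_apply (h1.clm_apply (by fun_prop)),
          fderiv_clm_apply h1 (by fun_prop)]
        simp
      have hsymm : IsSymmSndFDerivAt ℝ (iteratedFDeriv ℝ k g) x :=
        h2.isSymmSndFDerivAt (by simp)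
      rw [key, key, hsymm]
      have htail : Fin.tail (Fin.tail (v ∘ Equiv.swap (0 : Fin (k + 1)).castSucc (Fin.succ 0))) =
          Fin.tail (Fin.tail v) := by
        ext j
        simp only [Fin.tail, Function.comp_apply]
        rw [Equiv.swap_apply_of_ne_of_ne] <;> simp [Fin.ext_iff]
      rw [htail]
      simp

/-- The `k`-th derivative of a real `C ^ k` function is symmetric. (The statement for general
fields, `ContDiffAt.iteratedFDeriv_comp_perm`, assumes analyticity.) -/
theorem ContDiffAt.iteratedFDeriv_comp_perm_real {E F : Type*} [NormedAddCommGroup E]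
    [NormedSpace ℝ E] [NormedAddCommGroup F] [NormedSpace ℝ F] {g : E → F} {x : E} {k : ℕ}
    (hg : ContDiffAt ℝ k g x) (v : Fin k → E) (σ : Equiv.Perm (Fin k)) :
    iteratedFDeriv ℝ k g x (v ∘ σ) = iteratedFDeriv ℝ k g x v := by
  cases k with
  | zero => congr 1; ext i; exact i.elim0
  | succ k =>
    have hσ : σ ∈ Submonoid.closure
        (Set.range fun i : Fin k => Equiv.swap i.castSucc i.succ) := by
      rw [Equiv.Perm.mclosure_swap_castSucc_succ]; trivial
    induction hσ using Submonoid.closure_induction generalizing v with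
    | mem τ hτ =>
      obtain ⟨i, rfl⟩ := hτ
      exact hg.iteratedFDeriv_comp_swap i v
    | one => rfl
    | mul τ ρ _ _ hτ hρ =>
      rw [Equiv.Perm.coe_mul, ← Function.comp_assoc, hρ, hτ]

/-- Taylor's formula in several variables, with remainder in big-O form. -/
theorem ContDiffAt.taylor_sub_isBigO {E F : Type*} [NormedAddCommGroup E] [NormedSpace ℝ E]
    [NormedAddCommGroup F] [NormedSpace ℝ F] [CompleteSpace F] {g : E → F} {x : E} {n : ℕ}
    (hg : ContDiffAt ℝ (n + 1) g x) :
    (fun y => g (x + y) - ∑ k ∈ Finset.range (n + 1),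
      ((k.factorial : ℝ)⁻¹ • (iteratedFDeriv ℝ k g x fun _ => y))) =O[𝓝 0]
      fun y => ‖y‖ ^ (n + 1) := by
  have hcont : ContinuousAt (iteratedFDeriv ℝ (n + 1) g) x := 
    hg.continuousAt_iteratedFDeriv le_rfl
  have hb : ∀ᶠ z in 𝓝 x, ‖iteratedFDeriv ℝ (n + 1) g z‖ < ‖iteratedFDeriv ℝ (n + 1) g x‖ + 1 :=
    hcont.norm.eventually_lt_const (by simp)
  have hd : ∀ᶠ z in 𝓝 x, ContDiffAt ℝ (n + 1) g z := hg.eventually (by simp)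
  obtain ⟨δ, hδ, hball⟩ := Metric.eventually_nhds_iff_ball.1 (hb.and hd)
  refine IsBigO.of_bound ((n.factorial : ℝ)⁻¹ * (‖iteratedFDeriv ℝ (n + 1) g x‖ + 1)) ?_
  filter_upwards [Metric.ball_mem_nhds (0 : E) hδ] with y hy
  have hseg : ∀ t ∈ Set.Icc (0 : ℝ) 1, x + t • y ∈ Metric.ball x δ := by
    intro t ht
    simp only [Metric.mem_ball, dist_self_add_left, norm_smul, dist_zero_right] at hy ⊢
    calc ‖t‖ * ‖y‖ ≤ 1 * ‖y‖ := by
          gcongr; rw [Real.norm_of_nonneg ht.1]; exact ht.2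
      _ < δ := by simpa using hy
  rw [map_add_eq_sum_add_integral_iteratedFDeriv fun t ht => (hball _ (hseg t ht)).2,
    add_sub_cancel_left, norm_smul, norm_inv, Real.norm_natCast, mul_assoc, norm_pow, norm_norm]
  gcongr
  have := intervalIntegral.norm_integral_le_of_norm_le_const (a := 0) (b := 1)
    (f := fun t : ℝ => (1 - t) ^ n • (iteratedFDeriv ℝ (n + 1) g (x + t • y) fun _ => y))
    (C := (‖iteratedFDeriv ℝ (n + 1) g x‖ + 1) * ‖y‖ ^ (n + 1)) ?_
  · simpa using this
  intro t ht
  rw [Set.uIoc_of_le zero_le_one] at ht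
  have ht' : t ∈ Set.Icc (0 : ℝ) 1 := ⟨ht.1.le, ht.2⟩
  rw [norm_smul]
  calc ‖(1 - t) ^ n‖ * ‖iteratedFDeriv ℝ (n + 1) g (x + t • y) fun _ => y‖
      ≤ 1 * ((‖iteratedFDeriv ℝ (n + 1) g x‖ + 1) * ‖y‖ ^ (n + 1)) := by
        gcongr
        · rw [norm_pow]
          exact pow_le_one₀ (norm_nonneg _) (by
            rw [Real.norm_of_nonneg (by linarith [ht.2])]; linarith [ht.1])
        · refine (ContinuousMultilinearMap.le_opNorm _ _).trans ?_
          simp only [Finset.prod_const, Finset.card_univ, Fintype.card_fin]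
          gcongr
          exact (hball _ (hseg t ht')).1.le
    _ = _ := one_mul _

/-- Polarization for iterated derivatives: they are symmetric, hence determined by their
values on the diagonal. -/
theorem ContDiffAt.iteratedFDeriv_eq_zero_of_diag {E F : Type*} [NormedAddCommGroup E]
    [NormedSpace ℝ E] [NormedAddCommGroup F] [NormedSpace ℝ F] {g : E → F} {x : E} {k : ℕ}
    (hg : ContDiffAt ℝ k g x)
    (h : ∀ y, (iteratedFDeriv ℝ k g x fun _ => y) = 0) : iteratedFDeriv ℝ k g x = 0 := by
  ext v
  have h1 := (iteratedFDeriv ℝ k g x).iteratedFDeriv_comp_diagonal (0 : E) v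
  have h2 : (fun y => iteratedFDeriv ℝ k g x fun _ => y) = fun _ => (0 : F) := funext h
  have h3 : ∀ σ : Equiv.Perm (Fin k), (iteratedFDeriv ℝ k g x fun i => v (σ i)) =
      iteratedFDeriv ℝ k g x v := fun σ => hg.iteratedFDeriv_comp_perm_real v σ
  rw [h2] at h1
  simp only [h3, Finset.sum_const, Finset.card_univ, Fintype.card_perm, Fintype.card_fin] at h1
  rw [show iteratedFDeriv ℝ k (fun _ : E => (0 : F)) 0 = 0 by simp] at h1
  have h4 : (k.factorial : ℝ) • iteratedFDeriv ℝ k g x v = 0 := by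
    rw [Nat.cast_smul_eq_nsmul, ← h1]; rfl
  exact (smul_eq_zero.1 h4).resolve_left (by exact_mod_cast k.factorial_ne_zero)

/-- The `n`-jet of `g` vanishes at `x` iff `g` is `O(‖y - x‖ ^ (n + 1))` at `x`. The growth
condition is insensitive to bi-Lipschitz changes of variables, and this is what makes the order of a
zero easy to transport between charts and along flows. -/
theorem ContDiffAt.iteratedFDeriv_eq_zero_iff_isBigO {E F : Type*} [NormedAddCommGroup E]
    [NormedSpace ℝ E] [NormedAddCommGroup F] [NormedSpace ℝ F] [CompleteSpace F]
    {g : E → F} {x : E} {n : ℕ} (hg : ContDiffAt ℝ (n + 1) g x) :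
    (∀ k ≤ n, iteratedFDeriv ℝ k g x = 0) ↔ g =O[𝓝 x] fun y => ‖y - x‖ ^ (n + 1) := by
  have hshift : g =O[𝓝 x] (fun y => ‖y - x‖ ^ (n + 1)) ↔
      (fun y => g (x + y)) =O[𝓝 0] fun y => ‖y‖ ^ (n + 1) := by
    have : 𝓝 x = map (fun y => x + y) (𝓝 0) := by simp
    rw [this, isBigO_map]
    simp [Function.comp_def]
  rw [hshift]
  constructor
  · intro h
    refine hg.taylor_sub_isBigO.congr_left fun y => ?_
    rw [Finset.sum_eq_zero, sub_zero]
    intro k hk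
    rw [h k (Nat.lt_succ_iff.1 (Finset.mem_range.1 hk))]
    simp
  · intro h k
    induction k using Nat.strong_induction_on with
    | _ k ih =>
      intro hk
      have hgk : ContDiffAt ℝ (k + 1) g x := hg.of_le (by gcongr)
      refine (hgk.of_le (by norm_cast; simp)).iteratedFDeriv_eq_zero_of_diag
        (IsBigO.continuousMultilinearMap_apply_eq_zero ?_)
      have h1 : (fun y => g (x + y)) =O[𝓝 0] fun y => ‖y‖ ^ (k + 1) := by
        refine h.trans (IsBigO.of_bound 1 ?_)
        filter_upwards [Metric.ball_mem_nhds (0 : E) one_pos] with y hy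
        rw [one_mul, norm_pow, norm_pow, norm_norm]
        exact pow_le_pow_of_le_one (norm_nonneg _) (by simpa using (Metric.mem_ball.1 hy).le)
          (by omega)
      have h2 := (h1.sub hgk.taylor_sub_isBigO).const_smul_left (k.factorial : ℝ)
      refine h2.congr_left fun y => ?_
      rw [Pi.smul_apply, sub_sub_cancel, Finset.sum_range_succ, Finset.sum_eq_zero fun j hj => ?_]
      · rw [zero_add, smul_smul, mul_inv_cancel₀ (by exact_mod_cast k.factorial_ne_zero),
          one_smul]
      · rw [ih j (Finset.mem_range.1 hj) ((Finset.mem_range.1 hj).le.trans hk)]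
        simp

/-! ### Order of vanishing along trajectories -/

/-- Two-sided Grönwall inequality: if `‖u'‖ ≤ K ‖u‖` on an interval, the norms of `u` at any two
of its points are comparable, in either order. -/
theorem norm_le_exp_mul_norm_of_norm_deriv_le {E : Type*} [NormedAddCommGroup E]
    [NormedSpace ℝ E] {u u' : ℝ → E} {K a b : ℝ} (hK : 0 ≤ K)
    (hu : ∀ t ∈ Set.Icc a b, HasDerivWithinAt u (u' t) (Set.Icc a b) t)
    (hb : ∀ t ∈ Set.Icc a b, ‖u' t‖ ≤ K * ‖u t‖) {s t : ℝ}
    (hs : s ∈ Set.Icc a b) (ht : t ∈ Set.Icc a b) :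
    ‖u t‖ ≤ Real.exp (K * (b - a)) * ‖u s‖ := by
  have forward : ∀ (v v' : ℝ → E) (p q : ℝ), p ≤ q → q - p ≤ b - a →
      (∀ t ∈ Set.Icc p q, HasDerivWithinAt v (v' t) (Set.Icc p q) t) →
      (∀ t ∈ Set.Icc p q, ‖v' t‖ ≤ K * ‖v t‖) → ‖v q‖ ≤ Real.exp (K * (b - a)) * ‖v p‖ := by
    intro v v' p q hpq hab hv hvb
    have := norm_le_gronwallBound_of_norm_deriv_right_le (f := v) (f' := v') (δ := ‖v p‖) (K := K)
      (ε := 0) (a := p) (b := q) (fun t ht => (hv t ht).continuousWithinAt)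
      (fun t ht => (hv t ⟨ht.1, ht.2.le⟩).mono_of_mem_nhdsWithin
        (Icc_mem_nhdsGE_of_mem ht)) le_rfl
      (fun t ht => by simpa using hvb t ⟨ht.1, ht.2.le⟩) q ⟨hpq, le_rfl⟩
    rw [gronwallBound_ε0, mul_comm] at this
    refine this.trans ?_
    gcongr
  rcases le_total s t with hst | hst
  · have hsub : Set.Icc s t ⊆ Set.Icc a b := Set.Icc_subset_Icc hs.1 ht.2
    exact forward u u' s t hst (by linarith [hs.1, ht.2])
      (fun r hr => (hu r (hsub hr)).mono hsub) (fun r hr => hb r (hsub hr))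
  · have hsub : Set.MapsTo (fun r : ℝ => -r) (Set.Icc (-s) (-t)) (Set.Icc a b) := fun r hr =>
      ⟨by linarith [hr.2, ht.1], by linarith [hr.1, hs.2]⟩
    have := forward (fun r => u (-r)) (fun r => -u' (-r)) (-s) (-t) (by linarith)
      (by linarith [hs.2, ht.1])
      (fun r hr => by
        have h := (hu (-r) (hsub hr)).scomp r (hasDerivAt_neg r).hasDerivWithinAt hsub
        simpa [Function.comp_def] using h)
      (fun r hr => by simpa using hb (-r) (hsub hr))
    simpa using this

/-- The Picard-Lindelöf theorem, recording that the solution stays in the ball in which the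
vector field is controlled. -/
theorem IsPicardLindelof.exists_hasDerivWithinAt_mem_closedBall {E : Type*}
    [NormedAddCommGroup E] [NormedSpace ℝ E] [CompleteSpace E] {f : ℝ → E → E} {tmin tmax : ℝ}
    {t₀ : Set.Icc tmin tmax} {x₀ x : E} {a r L K : NNReal}
    (hf : IsPicardLindelof f t₀ x₀ a r L K) (hx : x ∈ Metric.closedBall x₀ r) :
    ∃ α : ℝ → E, α t₀ = x ∧
      (∀ t ∈ Set.Icc tmin tmax, HasDerivWithinAt α (f t (α t)) (Set.Icc tmin tmax) t) ∧
      ∀ t, α t ∈ Metric.closedBall x₀ a := by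
  obtain ⟨α, hα⟩ := ODE.FunSpace.exists_isFixedPt_next hf hx
  refine ⟨α.compProj, by rw [ODE.FunSpace.compProj_val, ← hα, ODE.FunSpace.next_apply₀],
    fun t ht => ?_, fun t => α.compProj_mem_closedBall hf.mul_max_le⟩
  apply ODE.hasDerivWithinAt_picard_Icc t₀.2 hf.continuousOn_uncurry
    α.continuous_compProj.continuousOn (fun _ ht' => α.compProj_mem_closedBall hf.mul_max_le)
    x ht |>.congr_of_mem _ ht
  intro t' ht'
  nth_rw 1 [← hα]
  rw [ODE.FunSpace.compProj_of_mem ht', ODE.FunSpace.next_apply]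

/-- Near a point where `V` is `C^1`, solutions of `α' = V α` exist for a time that is uniform in
the initial point, and stay in a prescribed ball. -/
theorem ContDiffAt.exists_localFlow_mem_ball {E : Type*} [NormedAddCommGroup E] [NormedSpace ℝ E]
    [CompleteSpace E] {V : E → E} {x₀ : E} (hV : ContDiffAt ℝ 1 V x₀) {R : ℝ} (hR : 0 < R) :
    ∃ r > (0 : ℝ), ∃ ε > (0 : ℝ), ∀ q ∈ Metric.closedBall x₀ r, ∃ α : ℝ → E, α 0 = q ∧
      (∀ t ∈ Set.Icc (-ε) ε, HasDerivWithinAt α (V (α t)) (Set.Icc (-ε) ε) t) ∧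
      ∀ t ∈ Set.Icc (-ε) ε, α t ∈ Metric.ball x₀ R := by
  obtain ⟨ε, hε, a, r, L, K, hr, hpl⟩ := IsPicardLindelof.of_contDiffAt_one hV
  have hpl := hpl 0
  have ha : 0 < a := by
    have h1 := hpl.mul_max_le
    have h2 : (0 : ℝ) ≤ L * max (0 + ε - 0) (0 - (0 - ε)) := by
      have : 0 ≤ max (0 + ε - 0) (0 - (0 - ε)) := le_max_of_le_left (by linarith)
      positivity
    have h3 : (0 : ℝ) < r := hr
    have : (0 : ℝ) < a := by linarith
    exact_mod_cast this
  obtain ⟨R', rfl⟩ : ∃ R' : NNReal, (R' : ℝ) = R := ⟨⟨R, hR.le⟩, rfl⟩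
  have hR' : 0 < R' := by exact_mod_cast hR
  set a' : NNReal := min a (R' / 2) with ha'
  have ha'0 : 0 < a' := lt_min ha (half_pos hR')
  have ha'R : a' < R' := (min_le_right _ _).trans_lt (half_lt_self hR')
  obtain ⟨ε', hε', hpl'⟩ := hpl.exists_shrink_radius hε (a' := a') (r' := a' / 2)
    (min_le_left _ _) (half_lt_self ha'0)
  refine ⟨(a' / 2 : NNReal), by exact_mod_cast half_pos ha'0, ε', hε', fun q hq => ?_⟩
  obtain ⟨α, h0, hd, hmem⟩ := hpl'.exists_hasDerivWithinAt_mem_closedBall hq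
  simp only [zero_sub, zero_add] at hd
  exact ⟨α, h0, hd, fun t _ =>
    Metric.closedBall_subset_ball (by exact_mod_cast ha'R) (hmem t)⟩

/-- Transport of the order of vanishing of `X` along a trajectory `c` of `V`, when
`‖DX V‖ ≤ K₂ ‖X‖`. A point `q` near `c t` is carried by `V` to a point `q'` near `c s`; by Grönwall
`‖X q‖ ≤ C ‖X q'‖` and `‖q' - c s‖ ≤ C ‖q - c t‖`. Neither direction of time is privileged. -/
theorem isBigO_pow_of_trajectory {E F : Type*} [NormedAddCommGroup E] [NormedSpace ℝ E]
    [NormedAddCommGroup F] [NormedSpace ℝ F] {V : E → E} {X : E → F} {S : Set E} {K₁ : NNReal}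
    {K₂ : ℝ} (hK₂ : 0 ≤ K₂) (hV : LipschitzOnWith K₁ V S)
    (hX : ∀ x ∈ S, DifferentiableAt ℝ X x) (hXV : ∀ x ∈ S, ‖fderiv ℝ X x (V x)‖ ≤ K₂ * ‖X x‖)
    {a b : ℝ} {c : ℝ → E}
    (hc : ∀ t ∈ Set.Icc a b, HasDerivWithinAt c (V (c t)) (Set.Icc a b) t)
    (hcS : ∀ t ∈ Set.Icc a b, c t ∈ S) {s t : ℝ} (hs : s ∈ Set.Icc a b) (ht : t ∈ Set.Icc a b)
    (hflow : ∀ᶠ q in 𝓝 (c t), ∃ σ : ℝ → E, σ t = q ∧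
      (∀ r ∈ Set.Icc a b, HasDerivWithinAt σ (V (σ r)) (Set.Icc a b) r) ∧
      ∀ r ∈ Set.Icc a b, σ r ∈ S)
    {n : ℕ} (hO : X =O[𝓝 (c s)] fun x => ‖x - c s‖ ^ n) :
    X =O[𝓝 (c t)] fun x => ‖x - c t‖ ^ n := by
  obtain ⟨C, hC, hO⟩ := hO.exists_pos
  obtain ⟨δ, hδ, hball⟩ := Metric.eventually_nhds_iff_ball.1 hO.bound
  set M := Real.exp (K₁ * (b - a)) with hM
  have hM0 : 0 < M := Real.exp_pos _
  refine IsBigO.of_bound (Real.exp (K₂ * (b - a)) * (C * M ^ n)) ?_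
  filter_upwards [hflow, Metric.ball_mem_nhds (c t) (div_pos hδ hM0)]
  rintro q ⟨σ, rfl, hσ, hσS⟩ hq
  have h1 : ‖σ s - c s‖ ≤ M * ‖σ t - c t‖ :=
    norm_le_exp_mul_norm_of_norm_deriv_le (u := fun r => σ r - c r) K₁.2
      (fun r hr => (hσ r hr).sub (hc r hr))
      (fun r hr => by
        simpa [dist_eq_norm] using hV.dist_le_mul _ (hσS r hr) _ (hcS r hr)) ht hs
  have h2 : ‖X (σ t)‖ ≤ Real.exp (K₂ * (b - a)) * ‖X (σ s)‖ :=
    norm_le_exp_mul_norm_of_norm_deriv_le (u := fun r => X (σ r)) hK₂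
      (fun r hr => (hX _ (hσS r hr)).hasFDerivAt.comp_hasDerivWithinAt r (hσ r hr))
      (fun r hr => hXV _ (hσS r hr)) hs ht
  have h3 : σ s ∈ Metric.ball (c s) δ := by
    rw [Metric.mem_ball, dist_eq_norm]
    rw [Metric.mem_ball, dist_eq_norm, lt_div_iff₀ hM0] at hq
    exact h1.trans_lt (by linarith)
  have h4 := hball _ h3
  rw [norm_pow, norm_norm] at h4 ⊢
  calc ‖X (σ t)‖ ≤ Real.exp (K₂ * (b - a)) * ‖X (σ s)‖ := h2
    _ ≤ Real.exp (K₂ * (b - a)) * (C * (M * ‖σ t - c t‖) ^ n) := by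
        gcongr
        exact h4.trans (by gcongr)
    _ = _ := by rw [mul_pow]; ring

/-- If `‖DX V‖ ≤ K ‖X‖` near a point, the order of vanishing of `X` is locally constant along an
integral curve of `V`. The neighbourhood of `t₀` is uniform in the order `n`. -/
theorem eventually_isBigO_pow_iff_of_integralCurve {E F : Type*} [NormedAddCommGroup E]
    [NormedSpace ℝ E] [CompleteSpace E] [NormedAddCommGroup F] [NormedSpace ℝ F]
    {V : E → E} {X : E → F} {c : ℝ → E} {t₀ K : ℝ} (hK : 0 ≤ K)
    (hV : ContDiffAt ℝ 1 V (c t₀)) (hX : ∀ᶠ x in 𝓝 (c t₀), DifferentiableAt ℝ X x)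
    (hXV : ∀ᶠ x in 𝓝 (c t₀), ‖fderiv ℝ X x (V x)‖ ≤ K * ‖X x‖)
    (hc : ∀ᶠ t in 𝓝 t₀, HasDerivAt c (V (c t)) t) :
    ∀ᶠ t in 𝓝 t₀, ∀ n : ℕ, (X =O[𝓝 (c t)] fun x => ‖x - c t‖ ^ n) ↔
      X =O[𝓝 (c t₀)] fun x => ‖x - c t₀‖ ^ n := by
  obtain ⟨K₁, U, hU, hLip⟩ := hV.exists_lipschitzOnWith
  obtain ⟨R, hR, hball⟩ := Metric.eventually_nhds_iff_ball.1 ((hX.and hXV).and hU)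
  obtain ⟨r, hr, ε, hε, hflow⟩ := hV.exists_localFlow_mem_ball hR
  have hcont : ContinuousAt c t₀ := hc.self_of_nhds.continuousAt
  have hcR : ∀ᶠ t in 𝓝 t₀, c t ∈ Metric.ball (c t₀) R :=
    hcont.eventually_mem (Metric.ball_mem_nhds _ hR)
  obtain ⟨ρ, hρ, hcρ⟩ := Metric.eventually_nhds_iff_ball.1 (hc.and hcR)
  set η := min (ρ / 3) (ε / 2) with hη
  have hη0 : 0 < η := lt_min (by linarith) (by linarith)
  have hηρ : 3 * η ≤ ρ := by linarith [min_le_left (ρ / 3) (ε / 2)]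
  have hηε : 2 * η ≤ ε := by linarith [min_le_right (ρ / 3) (ε / 2)]
  have key : ∀ s t : ℝ, s ∈ Metric.ball t₀ η → t ∈ Metric.ball t₀ η →
      c t ∈ Metric.ball (c t₀) r → ∀ n : ℕ, (X =O[𝓝 (c s)] fun x => ‖x - c s‖ ^ n) →
      X =O[𝓝 (c t)] fun x => ‖x - c t‖ ^ n := by
    intro s t hs ht htr n hO
    rw [Real.ball_eq_Ioo] at hs ht
    have hin : ∀ {u}, u ∈ Set.Icc (-(2 * η)) (2 * η) → u + t ∈ Metric.ball t₀ ρ := by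
      intro u hu
      rw [Real.ball_eq_Ioo]
      exact ⟨by linarith [hu.1, ht.1], by linarith [hu.2, ht.2]⟩
    have hsub : Set.Icc (-(2 * η)) (2 * η) ⊆ Set.Icc (-ε) ε :=
      Set.Icc_subset_Icc (by linarith) hηε
    have := isBigO_pow_of_trajectory (V := V) (X := X) (S := Metric.ball (c t₀) R) (K₁ := K₁) hK
      (hLip.mono fun x hx => (hball x hx).2) (fun x hx => (hball x hx).1.1)
      (fun x hx => (hball x hx).1.2) (a := -(2 * η)) (b := 2 * η) (c := fun u => c (u + t))
      (fun u hu => ((hcρ _ (hin hu)).1.comp_add_const u t).hasDerivWithinAt)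
      (fun u hu => (hcρ _ (hin hu)).2) (s := s - t) (t := 0)
      ⟨by linarith [hs.1, ht.2], by linarith [hs.2, ht.1]⟩ ⟨by linarith, by linarith⟩
      (by
        simp only [zero_add]
        filter_upwards [Metric.isOpen_ball.mem_nhds htr] with q hq
        obtain ⟨σ, h0, hσ, hσR⟩ := hflow q (Metric.ball_subset_closedBall hq)
        exact ⟨σ, h0, fun u hu => (hσ u (hsub hu)).mono hsub, fun u hu => hσR u (hsub hu)⟩)
      (n := n) (by simpa using hO)
    simpa using this
  filter_upwards [Metric.ball_mem_nhds t₀ hη0,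
    hcont.eventually_mem (Metric.ball_mem_nhds _ hr)] with t ht htr n
  exact ⟨key t t₀ ht (Metric.mem_ball_self hη0) (Metric.mem_ball_self hr) n,
    key t₀ t (Metric.mem_ball_self hη0) ht htr n⟩

/-! ### Division of smooth functions -/

open MeasureTheory in
/-- Smooth dependence on a parameter of an integral over `[0, 1]`. The integral is the value at `0`
of the convolution of the indicator function of `(0, 1]` with a compactly supported cut-off of
`t ↦ H (p, -t)`. -/
theorem ContDiff.integral_zero_one {P F : Type*} [NormedAddCommGroup P] [NormedSpace ℝ P]
    [NormedAddCommGroup F] [NormedSpace ℝ F] {H : P × ℝ → F} (hH : ContDiff ℝ ∞ H) :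
    ContDiff ℝ ∞ fun p => ∫ t in (0 : ℝ)..1, H (p, t) := by
  let φ : ContDiffBump (0 : ℝ) := ⟨1, 2, one_pos, one_lt_two⟩
  have h := contDiffOn_convolution_right_with_param_comp (𝕜 := ℝ) (n := ⊤) (μ := volume)
    (ContinuousLinearMap.lsmul ℝ ℝ : ℝ →L[ℝ] F →L[ℝ] F) (s := (Set.univ : Set P))
    (v := fun _ => (0 : ℝ)) contDiffOn_const (f := (Set.Ioc (0 : ℝ) 1).indicator fun _ => 1)
    (g := fun p x => φ x • H (p, -x)) (k := Metric.closedBall 0 2) isOpen_univ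
    (isCompact_closedBall _ _)
    (fun p x _ hx => by
      rw [φ.zero_of_le_dist (by simpa [φ] using (not_le.1 (mt Metric.mem_closedBall.2 hx)).le),
        zero_smul])
    (((integrableOn_const (by simp)).integrable_indicator measurableSet_Ioc).locallyIntegrable)
    (by
      refine ContDiff.contDiffOn ?_
      change ContDiff ℝ ∞ fun q : P × ℝ => φ q.2 • H (q.1, -q.2)
      have h1 : ContDiff ℝ ∞ fun q : P × ℝ => φ q.2 := φ.contDiff.comp contDiff_snd
      exact h1.smul (by fun_prop))
  rw [contDiffOn_univ] at h
  convert h using 2 with p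
  rw [convolution_def, intervalIntegral.integral_of_le zero_le_one,
    ← integral_indicator measurableSet_Ioc]
  congr 1 with t
  by_cases ht : t ∈ Set.Ioc (0 : ℝ) 1
  · have : φ (-t) = 1 := φ.one_of_mem_closedBall (by
      simp only [mem_closedBall_zero_iff, norm_neg, Real.norm_eq_abs, φ]
      rw [abs_of_pos ht.1]; exact ht.2)
    simp [ht, this]
  · simp [ht]

/-- Hadamard's lemma with parameters: `G (p, u) = u • ∫ t in 0..1, ∂ᵤ G (p, t u)` as soon as
`G (p, 0) = 0`. The same smooth
quotient serves all such `p`. -/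
theorem ContDiff.exists_eq_smul_of_eq_zero {P F : Type*} [NormedAddCommGroup P] [NormedSpace ℝ P]
    [NormedAddCommGroup F] [NormedSpace ℝ F] [CompleteSpace F] {G : P × ℝ → F}
    (hG : ContDiff ℝ ∞ G) :
    ∃ W : P × ℝ → F, ContDiff ℝ ∞ W ∧ ∀ p, G (p, 0) = 0 → ∀ u, G (p, u) = u • W (p, u) := by
  refine ⟨fun q => ∫ t in (0 : ℝ)..1, fderiv ℝ G (q.1, t * q.2) (0, 1), ?_, fun p hp u => ?_⟩
  · refine ContDiff.integral_zero_one (H := fun r : (P × ℝ) × ℝ =>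
      fderiv ℝ G (r.1.1, r.2 * r.1.2) (0, 1)) ?_
    have := hG.fderiv_right (m := ∞) (by simp)
    fun_prop
  · have hd : ∀ t : ℝ, HasDerivAt (fun t : ℝ => G (p, t * u))
        (u • fderiv ℝ G (p, t * u) (0, 1)) t := by
      intro t
      have h1 : HasDerivAt (fun t : ℝ => (p, t * u)) ((0 : P), u) t := by
        simpa using (hasDerivAt_const t p).prodMk ((hasDerivAt_id t).mul_const u)
      have h2 := (hG.differentiable (by simp) (p, t * u)).hasFDerivAt.comp_hasDerivAt t h1
      rw [← map_smul]
      simpa [Function.comp_def] using h2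
    have hcont : Continuous fun t : ℝ => u • fderiv ℝ G (p, t * u) (0, 1) := by
      have := (hG.fderiv_right (m := ∞) (by simp)).continuous
      fun_prop
    have := intervalIntegral.integral_eq_sub_of_hasDerivAt (a := 0) (b := 1)
      (fun t _ => hd t) (hcont.intervalIntegrable _ _)
    simp only [one_mul, zero_mul, hp, sub_zero] at this
    rw [← this, intervalIntegral.integral_smul]

/-- Iterated Hadamard division: a smooth function that is `O(|u| ^ n)` for all parameters in `A`
is there `u ^ n` times a smooth function. -/
theorem ContDiff.exists_eq_pow_smul_of_isBigO {P F : Type*} [NormedAddCommGroup P]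
    [NormedSpace ℝ P] [NormedAddCommGroup F] [NormedSpace ℝ F] [CompleteSpace F] {A : Set P}
    (n : ℕ) : ∀ {G : P × ℝ → F}, ContDiff ℝ ∞ G →
    (∀ p ∈ A, (fun u => G (p, u)) =O[𝓝 0] fun u => |u| ^ n) →
    ∃ W : P × ℝ → F, ContDiff ℝ ∞ W ∧ ∀ p ∈ A, ∀ u, G (p, u) = u ^ n • W (p, u) := by
  induction n with
  | zero => exact fun {G} hG _ => ⟨G, hG, fun p _ u => by simp⟩
  | succ n ih =>
    intro G hG hO
    obtain ⟨G₁, hG₁, hGG₁⟩ := hG.exists_eq_smul_of_eq_zero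
    have h0 : ∀ p ∈ A, G (p, 0) = 0 := fun p hp =>
      by
      obtain ⟨C, hC⟩ := (hO p hp).bound
      simpa using hC.self_of_nhds
    obtain ⟨W, hW, hGW⟩ := ih hG₁ (fun p hp => by
      obtain ⟨C, hC⟩ := (hO p hp).bound
      refine IsBigO.of_bound C ?_
      have hne : ∀ᶠ u in 𝓝 (0 : ℝ), u ≠ 0 → ‖G₁ (p, u)‖ ≤ C * ‖|u| ^ n‖ := by
        filter_upwards [hC] with u hu hu0
        rw [hGG₁ p (h0 p hp) u, norm_smul, Real.norm_eq_abs, norm_pow, norm_abs_eq_norm,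
          Real.norm_eq_abs, pow_succ, ← mul_assoc, mul_comm] at hu
        rw [norm_pow, norm_abs_eq_norm, Real.norm_eq_abs]
        exact le_of_mul_le_mul_right hu (abs_pos.2 hu0)
      -- the division by `u` only bounds `G₁` for `u ≠ 0`; continuity covers `u = 0`
      have hz : ‖G₁ (p, 0)‖ ≤ C * ‖|(0 : ℝ)| ^ n‖ := by
        have hc₁ : Continuous fun u : ℝ => ‖G₁ (p, u)‖ := by
          have := hG₁.continuous
          fun_prop
        have hc₂ : Continuous fun u : ℝ => C * ‖|u| ^ n‖ := by fun_prop
        exact le_of_tendsto_of_tendsto (b := 𝓝[≠] (0 : ℝ))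
          (hc₁.continuousAt.tendsto.mono_left nhdsWithin_le_nhds)
          (hc₂.continuousAt.tendsto.mono_left nhdsWithin_le_nhds)
          (eventually_nhdsWithin_iff.2 hne)
      filter_upwards [hne] with u hu
      rcases eq_or_ne u 0 with rfl | hu0
      · exact hz
      · exact hu hu0)
    exact ⟨W, hW, fun p hp u => by
      rw [hGG₁ p (h0 p hp) u, hGW p hp u, smul_smul, pow_succ']⟩

/-- The germ of a smooth function at a point extends to a globally smooth function. -/
theorem ContDiffOn.exists_contDiff_eventuallyEq {E F : Type*} [NormedAddCommGroup E]
    [NormedSpace ℝ E] [FiniteDimensional ℝ E] [NormedAddCommGroup F] [NormedSpace ℝ F]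
    {g : E → F} {U : Set E} {x₀ : E} (hg : ContDiffOn ℝ ∞ g U) (hU : U ∈ 𝓝 x₀) :
    ∃ g' : E → F, ContDiff ℝ ∞ g' ∧ g' =ᶠ[𝓝 x₀] g := by
  obtain ⟨r, hr, hrU⟩ := Metric.mem_nhds_iff.1 hU
  let φ : ContDiffBump x₀ := ⟨r / 4, r / 2, by linarith, by linarith⟩
  refine ⟨fun x => φ x • g x, contDiff_iff_contDiffAt.2 fun x => ?_, ?_⟩
  · by_cases hx : x ∈ Metric.ball x₀ r
    · exact φ.contDiff.contDiffAt.smul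
        ((hg.mono hrU).contDiffAt (Metric.isOpen_ball.mem_nhds hx))
    · have : (fun x => φ x • g x) =ᶠ[𝓝 x] fun _ => 0 := by
        have hx' : x ∈ (Metric.closedBall x₀ (r / 2))ᶜ := fun h =>
          hx (Metric.closedBall_subset_ball (by linarith) h)
        filter_upwards [Metric.isClosed_closedBall.isOpen_compl.mem_nhds hx'] with y hy
        rw [φ.zero_of_le_dist (not_le.1 (mt Metric.mem_closedBall.2 hy)).le, zero_smul]
      exact contDiffAt_const.congr_of_eventuallyEq this
  · filter_upwards [φ.eventuallyEq_one] with x hx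
    rw [hx]; simp

/-! ### Regularity of the tracking function in the plane -/

/-- The integral curve of `Y` through `x₀`, reparametrized so that a linear functional `lam` that
does not vanish on `Y x₀` increases with unit speed along it. Only the germ at `0` of the curve is
an integral curve; it is extended to a smooth map on the line. -/
theorem ContDiff.exists_integralCurve_param_by_linear {E : Type*} [NormedAddCommGroup E]
    [NormedSpace ℝ E] [FiniteDimensional ℝ E] {Y : E → E} (hY : ContDiff ℝ ∞ Y)
    (lam : E →L[ℝ] ℝ) {x₀ : E} (h0 : lam (Y x₀) ≠ 0) :
    ∃ γ : ℝ → E, ContDiff ℝ ∞ γ ∧ γ 0 = x₀ ∧ ∀ᶠ s in 𝓝 0,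
      HasDerivAt γ ((lam (Y (γ s)))⁻¹ • Y (γ s)) s ∧ lam (γ s) = lam x₀ + s := by
  have hlY : Continuous fun x => lam (Y x) := lam.continuous.comp hY.continuous
  have hU : {x | lam (Y x) ≠ 0} ∈ 𝓝 x₀ := hlY.continuousAt.eventually_ne h0
  obtain ⟨V, hV, hVeq⟩ : ∃ V : E → E, ContDiff ℝ ∞ V ∧
      V =ᶠ[𝓝 x₀] fun x => (lam (Y x))⁻¹ • Y x :=
    ContDiffOn.exists_contDiff_eventuallyEq
      (fun x hx => (((lam.contDiff.comp hY).contDiffAt.inv hx).smul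
        hY.contDiffAt).contDiffWithinAt) hU
  obtain ⟨α, hα0, ε, hε, hα⟩ :=
    (hV.contDiffAt.of_le (by simp) : ContDiffAt ℝ 1 V x₀)
      |>.exists_forall_mem_closedBall_exists_eq_forall_mem_Ioo_hasDerivAt₀ 0
  simp only [zero_sub, zero_add] at hα
  have hsub : Set.Icc (-(ε / 2)) (ε / 2) ⊆ Set.Ioo (-ε) ε :=
    Set.Icc_subset_Ioo (by linarith) (by linarith)
  have hαs : ContDiffOn ℝ ∞ α (Set.Icc (-(ε / 2)) (ε / 2)) :=
    ODE.contDiffOn_enat_Icc_of_hasDerivWithinAt (n := ⊤) (f := fun _ => V) (u := Set.univ)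
      (hV.comp contDiff_snd).contDiffOn (fun t ht => (hα t (hsub ht)).hasDerivWithinAt)
      (Set.mapsTo_univ _ _)
  obtain ⟨γ, hγ, hγα⟩ := hαs.exists_contDiff_eventuallyEq
    (Icc_mem_nhds (a := -(ε / 2)) (b := ε / 2) (x := 0) (by linarith) (by linarith))
  have hγ0 : γ 0 = x₀ := hγα.self_of_nhds.trans hα0
  have hVγ : ∀ᶠ s in 𝓝 (0 : ℝ), V (γ s) = (lam (Y (γ s)))⁻¹ • Y (γ s) ∧ lam (Y (γ s)) ≠ 0 := by
    have : Tendsto γ (𝓝 0) (𝓝 x₀) := by simpa [hγ0] using hγ.continuous.tendsto 0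
    exact this.eventually (hVeq.and hU)
  have hder : ∀ᶠ s in 𝓝 (0 : ℝ), HasDerivAt γ ((lam (Y (γ s)))⁻¹ • Y (γ s)) s ∧
      lam (Y (γ s)) ≠ 0 := by
    filter_upwards [hγα.eventuallyEq_nhds, Ioo_mem_nhds (neg_lt_zero.2 hε) hε, hVγ]
      with s hs hsI hsV
    refine ⟨?_, hsV.2⟩
    rw [← hsV.1, hs.self_of_nhds]
    exact (hα s hsI).congr_of_eventuallyEq hs
  refine ⟨γ, hγ, hγ0, ?_⟩
  obtain ⟨δ, hδ, hball⟩ := Metric.eventually_nhds_iff_ball.1 hder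
  filter_upwards [Metric.ball_mem_nhds (0 : ℝ) hδ] with s hs
  refine ⟨(hball s hs).1, ?_⟩
  have hd : ∀ t ∈ Metric.ball (0 : ℝ) δ, HasDerivAt (fun t => lam (γ t) - t) 0 t := by
    intro t ht
    have h1 := (lam.hasFDerivAt.comp_hasDerivAt t (hball t ht).1).sub (hasDerivAt_id t)
    simpa [inv_mul_cancel₀ (hball t ht).2] using! h1
  have := Metric.isOpen_ball.is_const_of_deriv_eq_zero Metric.isPreconnected_ball
    (fun t ht => (hd t ht).differentiableAt.differentiableWithinAt) (fun t ht => (hd t ht).deriv)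
    hs (Metric.mem_ball_self hδ)
  simp only [hγ0, sub_zero] at this
  linarith

/-- A coefficient `f` in `R = f W` with `W x₀ ≠ 0` is as smooth at `x₀` as `R` and `W` are. -/
theorem contDiffAt_of_eventually_eq_smul {E F : Type*} [NormedAddCommGroup E] [NormedSpace ℝ E]
    [NormedAddCommGroup F] [NormedSpace ℝ F] {f : E → ℝ} {R W : E → F} {x₀ : E}
    {n : WithTop ℕ∞} (hR : ContDiffAt ℝ n R x₀) (hW : ContDiffAt ℝ n W x₀) (hW0 : W x₀ ≠ 0)
    (h : ∀ᶠ x in 𝓝 x₀, R x = f x • W x) : ContDiffAt ℝ n f x₀ := by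
  obtain ⟨θ, -, hθ⟩ := exists_dual_vector ℝ (W x₀) (norm_ne_zero_iff.2 hW0)
  have hne : θ (W x₀) ≠ 0 := by
    rw [hθ]; simpa using hW0
  have hθW : ContDiffAt ℝ n (fun x => θ (W x)) x₀ := θ.contDiff.contDiffAt.comp x₀ hW
  have hθR : ContDiffAt ℝ n (fun x => θ (R x)) x₀ := θ.contDiff.contDiffAt.comp x₀ hR
  refine (hθR.div hθW hne).congr_of_eventuallyEq ?_
  filter_upwards [h, hθW.continuousAt.eventually_ne hne] with x hx hx0
  change f x = θ (R x) / θ (W x)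
  rw [hx, map_smul, smul_eq_mul, mul_div_cancel_right₀ _ hx0]

/-- Division by `ℓ ^ n` in the coordinates `x = γ (σ x) + ℓ x • w`: a smooth `G` that vanishes to
order `n` in the direction `w` along the curve `γ = {ℓ = 0}` is `ℓ ^ n` times a smooth function. -/
theorem ContDiff.exists_eventually_eq_pow_smul {E F : Type*} [NormedAddCommGroup E]
    [NormedSpace ℝ E] [NormedAddCommGroup F] [NormedSpace ℝ F] [CompleteSpace F] {G : E → F}
    (hG : ContDiff ℝ ∞ G) {γ : ℝ → E} (hγ : ContDiff ℝ ∞ γ) {w x₀ : E} {σ ℓ : E → ℝ}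
    (hσ : ContDiff ℝ ∞ σ) (hℓ : ContDiff ℝ ∞ ℓ) (hσ0 : σ x₀ = 0)
    (hcoord : ∀ᶠ x in 𝓝 x₀, γ (σ x) + ℓ x • w = x) {n : ℕ}
    (hO : ∀ᶠ s in 𝓝 (0 : ℝ), (fun u : ℝ => G (γ s + u • w)) =O[𝓝 0] fun u => |u| ^ n) :
    ∃ W : E → F, ContDiff ℝ ∞ W ∧ ∀ᶠ x in 𝓝 x₀, G x = ℓ x ^ n • W x := by
  have hΦ : ContDiff ℝ ∞ fun q : ℝ × ℝ => γ q.1 + q.2 • w :=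
    (hγ.comp contDiff_fst).add (contDiff_snd.smul contDiff_const)
  obtain ⟨W, hW, hGW⟩ := ContDiff.exists_eq_pow_smul_of_isBigO n
    (G := fun q : ℝ × ℝ => G (γ q.1 + q.2 • w)) (hG.comp hΦ) (fun s hs => hs)
  refine ⟨fun x => W (σ x, ℓ x), hW.comp (hσ.prodMk hℓ), ?_⟩
  have hσt : Tendsto σ (𝓝 x₀) (𝓝 0) := by simpa [hσ0] using hσ.continuous.tendsto x₀
  filter_upwards [hcoord, hσt.eventually hO] with x hx hs
  simpa [hx] using hGW (σ x) hs (ℓ x)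

/-- Local form of the regularity of the tracking function at a point `x₀` where `X` vanishes to
finite order `n` (possibly `0`) and `Y` does not vanish.

The functionals `lam`, `mu` and the vector `w` are linear coordinates on a plane with `Y x₀`
transverse to `w`. The integral curve `γ` of `Y` through `x₀` is a graph over `lam`, with defining
function `ℓ`. As `X` vanishes to order `n` along `γ`, `X = ℓ ^ n W` with `W` smooth and `W x₀ ≠ 0`;
as `Y` is tangent to `γ`, `Y ℓ = ℓ b` with `b` smooth. Dividing `[Y, X] = f X` by `ℓ ^ n` gives
`[Y, W] + n b W = f W`, first off `γ` and then by continuity of `f` everywhere near `x₀`. -/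
theorem contDiffAt_of_bracket_eq_smul_of_finite_order {E : Type*} [NormedAddCommGroup E]
    [NormedSpace ℝ E] [FiniteDimensional ℝ E] {X Y : E → E} (hX : ContDiff ℝ ∞ X)
    (hY : ContDiff ℝ ∞ Y) {f : E → ℝ} {x₀ : E} (hf : ∀ᶠ x in 𝓝 x₀, ContinuousAt f x)
    (hbr : ∀ᶠ x in 𝓝 x₀, fderiv ℝ X x (Y x) - fderiv ℝ Y x (X x) = f x • X x)
    {lam mu : E →L[ℝ] ℝ} {w : E} (hlw : lam w = 0) (hmw : mu w = 1)
    (hker : ∀ x, lam x = 0 → x = mu x • w) (hY0 : lam (Y x₀) ≠ 0) {n : ℕ}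
    (hO : X =O[𝓝 x₀] fun x => ‖x - x₀‖ ^ n) (hnO : ¬ X =O[𝓝 x₀] fun x => ‖x - x₀‖ ^ (n + 1)) :
    ContDiffAt ℝ ∞ f x₀ := by
  obtain ⟨γ, hγ, hγ0, hγd⟩ := hY.exists_integralCurve_param_by_linear lam hY0
  have hlY : Continuous fun x => lam (Y x) := lam.continuous.comp hY.continuous
  have hlYne : ∀ᶠ x in 𝓝 x₀, lam (Y x) ≠ 0 := hlY.continuousAt.eventually_ne hY0
  have hX1 : Differentiable ℝ X := hX.differentiable (by simp)
  have hY1 : Differentiable ℝ Y := hY.differentiable (by simp)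
  have hDX : ContDiff ℝ ∞ (fderiv ℝ X) := hX.fderiv_right (by simp)
  have hDY : ContDiff ℝ ∞ (fderiv ℝ Y) := hY.fderiv_right (by simp)
  -- `X` vanishes to order `n` along `γ`: for `V = (lam Y)⁻¹ Y`, the tracking equation still bounds
  -- `DX V = (lam Y)⁻¹ (DY X + f X)` by a multiple of `X`
  have hOγ : ∀ᶠ s in 𝓝 (0 : ℝ), X =O[𝓝 (γ s)] fun x => ‖x - γ s‖ ^ n := by
    have hg : ContinuousAt (fun x => |(lam (Y x))⁻¹| * (‖fderiv ℝ Y x‖ + |f x|)) x₀ :=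
      ((hlY.continuousAt.inv₀ hY0).abs).mul
        (hDY.continuous.continuousAt.norm.add hf.self_of_nhds.abs)
    set K := |(lam (Y x₀))⁻¹| * (‖fderiv ℝ Y x₀‖ + |f x₀|) + 1 with hK
    have hK0 : 0 ≤ K := by positivity
    have := eventually_isBigO_pow_iff_of_integralCurve (V := fun x => (lam (Y x))⁻¹ • Y x) (X := X)
      (c := γ) (t₀ := 0) hK0
      (by
        rw [hγ0]
        exact ((lam.contDiff.comp hY).contDiffAt.inv hY0 |>.smul hY.contDiffAt).of_le (by simp))
      (Eventually.of_forall fun x => hX1 x)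
      (by
        rw [hγ0]
        filter_upwards [hbr, hg.eventually_lt_const (lt_add_one _)] with x hx hxK
        rw [sub_eq_iff_eq_add] at hx
        rw [map_smul, hx, norm_smul, Real.norm_eq_abs]
        calc |(lam (Y x))⁻¹| * ‖f x • X x + fderiv ℝ Y x (X x)‖
            ≤ |(lam (Y x))⁻¹| * (|f x| * ‖X x‖ + ‖fderiv ℝ Y x‖ * ‖X x‖) := by
              gcongr
              refine (norm_add_le _ _).trans ?_
              gcongr
              · rw [norm_smul, Real.norm_eq_abs]
              · exact ContinuousLinearMap.le_opNorm _ _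
          _ = |(lam (Y x))⁻¹| * (‖fderiv ℝ Y x‖ + |f x|) * ‖X x‖ := by ring
          _ ≤ K * ‖X x‖ := by gcongr)
      (hγd.mono fun s hs => hs.1)
    filter_upwards [this] with s hs
    exact (hs n).2 (by rwa [hγ0])
  -- coordinates `x = γ (σ x) + ℓ x • w`, in which `γ` is the set `ℓ = 0`
  set σ : E → ℝ := fun x => lam x - lam x₀ with hσ
  set ℓ : E → ℝ := fun x => mu (x - γ (σ x)) with hℓ
  have hσs : ContDiff ℝ ∞ σ := lam.contDiff.sub contDiff_const
  have hℓs : ContDiff ℝ ∞ ℓ := mu.contDiff.comp (contDiff_id.sub (hγ.comp hσs))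
  have hσ0 : σ x₀ = 0 := sub_self _
  have hℓ0 : ℓ x₀ = 0 := by simp [hℓ, hσ0, hγ0]
  have hσt : Tendsto σ (𝓝 x₀) (𝓝 0) := by simpa [hσ0] using hσs.continuous.tendsto x₀
  have hcoord : ∀ᶠ x in 𝓝 x₀, γ (σ x) + ℓ x • w = x := by
    filter_upwards [hσt.eventually hγd] with x hx
    have : lam (x - γ (σ x)) = 0 := by rw [map_sub, hx.2]; simp [hσ]
    rw [← hker _ this]; abel
  have hline : ∀ s, Tendsto (fun u : ℝ => γ s + u • w) (𝓝 0) (𝓝 (γ s)) := fun s => by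
    have : Continuous fun u : ℝ => γ s + u • w := by fun_prop
    simpa using this.tendsto 0
  obtain ⟨W, hW, hXW⟩ := hX.exists_eventually_eq_pow_smul hγ (w := w) hσs hℓs hσ0 hcoord (n := n)
    (by
      filter_upwards [hOγ] with s hs
      refine (hs.comp_tendsto (hline s)).trans (IsBigO.of_bound (‖w‖ ^ n) ?_)
      refine Eventually.of_forall fun u => le_of_eq ?_
      simp [norm_smul, mul_pow, mul_comm])
  -- otherwise `X = ℓ ^ n W` would be `O(‖x - x₀‖ ^ (n + 1))`
  have hW0 : W x₀ ≠ 0 := by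
    intro h0
    refine hnO ?_
    have h1 : W =O[𝓝 x₀] fun x => ‖x - x₀‖ := by
      simpa [h0] using (hW.differentiable (by simp) x₀).isBigO_sub.norm_right
    have h2 : ℓ =O[𝓝 x₀] fun x => ‖x - x₀‖ := by
      simpa [hℓ0] using (hℓs.differentiable (by simp) x₀).isBigO_sub.norm_right
    refine ((h2.pow n).smul h1).congr' (hXW.mono fun x hx => hx.symm) ?_
    exact Eventually.of_forall fun x => by simp [pow_succ]
  -- `Y ℓ = ℓ * b`, since `ℓ` vanishes on a curve tangent to `Y`
  have hYℓ : ContDiff ℝ ∞ fun x => fderiv ℝ ℓ x (Y x) :=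
    (hℓs.fderiv_right (by simp)).clm_apply hY
  have hYℓ0 : ∀ᶠ s in 𝓝 (0 : ℝ), fderiv ℝ ℓ (γ s) (Y (γ s)) = 0 := by
    have hℓγ : ∀ᶠ s in 𝓝 (0 : ℝ), ℓ (γ s) = 0 := by
      filter_upwards [hγd] with s hs
      simp [hℓ, hσ, hs.2]
    have hne : ∀ᶠ s in 𝓝 (0 : ℝ), lam (Y (γ s)) ≠ 0 := by
      have : Tendsto γ (𝓝 0) (𝓝 x₀) := by simpa [hγ0] using hγ.continuous.tendsto 0
      exact this.eventually hlYne
    filter_upwards [hℓγ.eventually_nhds, hγd, hne] with s hs hsd hsne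
    have h1 := (hℓs.differentiable (by simp) (γ s)).hasFDerivAt.comp_hasDerivAt s hsd.1
    have h2 : HasDerivAt (ℓ ∘ γ) 0 s := (hasDerivAt_const s 0).congr_of_eventuallyEq hs
    have h3 := h1.unique h2
    rw [map_smul, smul_eq_mul] at h3
    exact (mul_eq_zero.1 h3).resolve_left (inv_ne_zero hsne)
  obtain ⟨b, hb, hYb⟩ := hYℓ.exists_eventually_eq_pow_smul hγ (w := w) hσs hℓs hσ0 hcoord (n := 1)
    (by
      filter_upwards [hYℓ0] with s hs
      have h1 := (hYℓ.differentiable (by simp) (γ s)).isBigO_sub.comp_tendsto (hline s)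
      simp only [hs, sub_zero] at h1
      refine h1.trans (IsBigO.of_bound ‖w‖ (Eventually.of_forall fun u => le_of_eq ?_))
      simp [norm_smul, mul_comm])
  -- cancel `ℓ ^ n` in `[Y, X] = f X`
  set R : E → E := fun x => (n * b x) • W x + fderiv ℝ W x (Y x) - fderiv ℝ Y x (W x) with hR
  have hRs : ContDiff ℝ ∞ R :=
    (((contDiff_const.mul hb).smul hW).add ((hW.fderiv_right (by simp)).clm_apply hY)).sub
      (hDY.clm_apply hW)
  have hmul : ∀ᶠ x in 𝓝 x₀, ℓ x ^ n • R x = ℓ x ^ n • (f x • W x) := by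
    filter_upwards [hXW.eventually_nhds, hbr, hYb] with x hx hxbr hxb
    have hd : HasFDerivAt X (ℓ x ^ n • fderiv ℝ W x +
        ((n * ℓ x ^ (n - 1)) • fderiv ℝ ℓ x).smulRight (W x)) x := by
      have h1 := ((hℓs.differentiable (by simp) x).hasFDerivAt.pow n).smul
        (hW.differentiable (by simp) x).hasFDerivAt
      refine HasFDerivAt.congr_of_eventuallyEq ?_ hx
      simpa using! h1
    -- for `n = 0` the exponent `n - 1` is truncated, harmlessly since the factor `n` vanishes
    have hn : (n : ℝ) * ℓ x ^ (n - 1) * (ℓ x * b x) = ℓ x ^ n * (n * b x) := by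
      rcases n with _ | n
      · simp
      · simp only [Nat.add_sub_cancel]; ring
    rw [hd.fderiv, hx.self_of_nhds, map_smul] at hxbr
    simp only [add_apply, smul_apply,
      ContinuousLinearMap.smulRight_apply, hxb, pow_one, smul_eq_mul] at hxbr
    rw [hn] at hxbr
    rw [smul_comm, ← hxbr, hR]
    simp only [smul_add, smul_sub, smul_smul]
    abel
  have hRf : ∀ᶠ x in 𝓝 x₀, R x = f x • W x := by
    filter_upwards [hmul.eventually_nhds, hf, hcoord] with x hx hfx hxc
    -- points with `ℓ ≠ 0` accumulate at `x` in the direction `w`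
    have hl : Tendsto (fun u : ℝ => x + u • w) (𝓝[≠] 0) (𝓝 x) := by
      have : Continuous fun u : ℝ => x + u • w := by fun_prop
      have h := this.tendsto 0
      simp only [zero_smul, add_zero] at h
      exact h.mono_left nhdsWithin_le_nhds
    have hℓl : ∀ u : ℝ, ℓ (x + u • w) = ℓ x + u := fun u => by
      simp only [hℓ, hσ, map_add, map_sub, map_smul, hlw, hmw, smul_eq_mul, mul_one, mul_zero,
        add_zero]
      ring
    have hne : ∀ᶠ u in 𝓝[≠] (0 : ℝ), ℓ x + u ≠ 0 := by
      rcases eq_or_ne (ℓ x) 0 with h0 | h0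
      · filter_upwards [self_mem_nhdsWithin] with u hu
        simpa [h0] using hu
      · have : Continuous fun u : ℝ => ℓ x + u := by fun_prop
        exact (this.continuousAt.eventually_ne (by simpa using h0)).filter_mono nhdsWithin_le_nhds
    refine tendsto_nhds_unique_of_eventuallyEq (l := 𝓝[≠] (0 : ℝ))
      (hRs.continuous.continuousAt.tendsto.comp hl)
      ((hfx.smul hW.continuous.continuousAt).tendsto.comp hl) ?_
    filter_upwards [hl.eventually hx, hne] with u hu hu0
    refine smul_right_injective E (pow_ne_zero n hu0) ?_
    simpa [hℓl] using hu
  exact contDiffAt_of_eventually_eq_smul hRs.contDiffAt hW.contDiffAt hW0 hRf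

/-! ### Vector fields in charts -/

section Charts

variable {m : ℕ} {M : Type*} [TopologicalSpace M] [ChartedSpace (EuclideanSpace ℝ (Fin m)) M]
  [IsManifold (𝓡 m) ∞ M] {X Y : (x : M) → TangentSpace (𝓡 m) x} {p q x : M}

theorem contMDiffAt_extChartAt_symm_of_mem_target {y : EuclideanSpace ℝ (Fin m)}
    (hy : y ∈ (extChartAt (𝓡 m) p).target) :
    ContMDiffAt 𝓘(ℝ, EuclideanSpace ℝ (Fin m)) (𝓡 m) ∞ (extChartAt (𝓡 m) p).symm y :=
  (contMDiffOn_extChartAt_symm p).contMDiffAt ((isOpen_extChartAt_target p).mem_nhds hy)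

theorem isInvertible_mfderiv_extChartAt_symm_of_mem_target {y : EuclideanSpace ℝ (Fin m)}
    (hy : y ∈ (extChartAt (𝓡 m) p).target) :
    (mfderiv 𝓘(ℝ, EuclideanSpace ℝ (Fin m)) (𝓡 m) (extChartAt (𝓡 m) p).symm y).IsInvertible := by
  have := isInvertible_mfderivWithin_extChartAt_symm (I := 𝓡 m) (x := p) hy
  simpa using this

theorem coordRep_eq_mfderiv_apply {y : EuclideanSpace ℝ (Fin m)}
    (hy : y ∈ (extChartAt (𝓡 m) p).target) :
    coordRep X p y = mfderiv (𝓡 m) 𝓘(ℝ, EuclideanSpace ℝ (Fin m)) (extChartAt (𝓡 m) p)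
      ((extChartAt (𝓡 m) p).symm y) (X ((extChartAt (𝓡 m) p).symm y)) := by
  have h1 := mfderivWithin_extChartAt_symm_comp_mfderiv_extChartAt (I := 𝓡 m) hy
  have h2 := mfderiv_extChartAt_comp_mfderivWithin_extChartAt_symm (I := 𝓡 m) hy
  simp only [modelWithCornersSelf_coe, Set.range_id, mfderivWithin_univ] at h1 h2
  exact DFunLike.congr_fun (ContinuousLinearMap.inverse_eq h1 h2) _

theorem coordRep_extChartAt (hx : x ∈ (extChartAt (𝓡 m) p).source) :
    coordRep X p (extChartAt (𝓡 m) p x) =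
      mfderiv (𝓡 m) 𝓘(ℝ, EuclideanSpace ℝ (Fin m)) (extChartAt (𝓡 m) p) x (X x) := by
  have := coordRep_eq_mfderiv_apply (X := X) ((extChartAt (𝓡 m) p).map_source hx)
  rwa [(extChartAt (𝓡 m) p).left_inv hx] at this

theorem coordRep_eq_zero_iff (hx : x ∈ (extChartAt (𝓡 m) p).source) :
    coordRep X p (extChartAt (𝓡 m) p x) = 0 ↔ X x = 0 := by
  rw [coordRep_extChartAt hx]
  have hinv := isInvertible_mfderiv_extChartAt (I := 𝓡 m) hx
  exact map_eq_zero_iff _ hinv.injective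

theorem IsSmoothVectorField.contDiffOn_coordRep (hX : IsSmoothVectorField X) (p : M) :
    ContDiffOn ℝ ∞ (coordRep X p) (extChartAt (𝓡 m) p).target := by
  intro y hy
  refine ContDiffAt.contDiffWithinAt ?_
  have := ContMDiffAt.mpullback_vectorField_preimage (m := ∞) (n := ∞)
    (hX ((extChartAt (𝓡 m) p).symm y)) (contMDiffAt_extChartAt_symm_of_mem_target hy)
    (isInvertible_mfderiv_extChartAt_symm_of_mem_target hy) (by simp)
  exact contMDiffAt_vectorSpace_iff_contDiffAt.1 this

/-- The tracking equation `[Y, X] = f X` in a chart, at every point of the target and not only at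
the base point of the chart. -/
theorem coordRep_lieBracket {f : M → ℝ} (hX : IsSmoothVectorField X)
    (hY : IsSmoothVectorField Y) (hf : IsTrackingFunction Y X f) {y : EuclideanSpace ℝ (Fin m)}
    (hy : y ∈ (extChartAt (𝓡 m) p).target) :
    fderiv ℝ (coordRep X p) y (coordRep Y p y) - fderiv ℝ (coordRep Y p) y (coordRep X p y) =
      f ((extChartAt (𝓡 m) p).symm y) • coordRep X p y := by
  have : IsManifold (𝓡 m) (minSmoothness ℝ 3) M := by
    rw [minSmoothness_of_isRCLikeNormedField]; exact IsManifold.of_le (n := ∞) (by norm_cast)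
  have : IsManifold (𝓡 m) (minSmoothness ℝ 2) M := by
    rw [minSmoothness_of_isRCLikeNormedField]; exact IsManifold.of_le (n := ∞) (by norm_cast)
  have h := VectorField.mpullback_mlieBracket (n := ∞)
    (((hY ((extChartAt (𝓡 m) p).symm y))).mdifferentiableAt (by simp))
    (((hX ((extChartAt (𝓡 m) p).symm y))).mdifferentiableAt (by simp))
    (contMDiffAt_extChartAt_symm_of_mem_target hy)
      (by rw [minSmoothness_of_isRCLikeNormedField]; norm_cast)
  have hfX : VectorField.mlieBracket (𝓡 m) Y X = f • X := funext hf.2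
  rw [hfX, VectorField.mpullback_smul_apply] at h
  have hflat : ∀ A B : EuclideanSpace ℝ (Fin m) → EuclideanSpace ℝ (Fin m),
      VectorField.mlieBracket 𝓘(ℝ, EuclideanSpace ℝ (Fin m)) A B y =
        fderiv ℝ B y (A y) - fderiv ℝ A y (B y) := fun A B =>
    (congrFun VectorField.mlieBracketWithin_univ.symm y).trans
      ((congrFun VectorField.mlieBracketWithin_eq_lieBracketWithin y).trans
        (congrFun VectorField.lieBracketWithin_univ y))
  exact (hflat (coordRep Y p) (coordRep X p)).symm.trans h.symm

theorem coordRep_change_chart (hp : x ∈ (extChartAt (𝓡 m) p).source)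
    (hq : x ∈ (extChartAt (𝓡 m) q).source) :
    coordRep X q (extChartAt (𝓡 m) q x) =
      fderiv ℝ (extChartAt (𝓡 m) q ∘ (extChartAt (𝓡 m) p).symm) (extChartAt (𝓡 m) p x)
        (coordRep X p (extChartAt (𝓡 m) p x)) := by
  have hy := (extChartAt (𝓡 m) p).map_source hp
  have hxx := (extChartAt (𝓡 m) p).left_inv hp
  have hq' : (extChartAt (𝓡 m) p).symm (extChartAt (𝓡 m) p x) ∈ (extChartAt (𝓡 m) q).source := by
    rwa [hxx]
  have h := mfderiv_comp (extChartAt (𝓡 m) p x)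
    ((contMDiffAt_extChartAt' (n := ∞) (by simpa using hq')).mdifferentiableAt (by simp))
    ((contMDiffAt_extChartAt_symm_of_mem_target hy).mdifferentiableAt (by simp))
  rw [← mfderiv_eq_fderiv, h]
  have hinv := isInvertible_mfderiv_extChartAt_symm_of_mem_target hy
  have h2 := hinv.self_apply_inverse (X ((extChartAt (𝓡 m) p).symm (extChartAt (𝓡 m) p x)))
  have h3 := (coordRep_extChartAt (X := X) hq').trans (congrArg (mfderiv (𝓡 m)
    𝓘(ℝ, EuclideanSpace ℝ (Fin m)) (extChartAt (𝓡 m) q)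
    ((extChartAt (𝓡 m) p).symm (extChartAt (𝓡 m) p x))) h2.symm)
  refine (congrArg (fun z => coordRep X q (extChartAt (𝓡 m) q z)) hxx).symm.trans h3

theorem hasDerivAt_extChartAt_comp_integralCurve {γ : ℝ → M} {t : ℝ}
    (hγ : HasMFDerivAt 𝓘(ℝ, ℝ) (𝓡 m) γ t ((1 : ℝ →L[ℝ] ℝ).smulRight (Y (γ t))))
    (hp : γ t ∈ (extChartAt (𝓡 m) p).source) :
    HasDerivAt (extChartAt (𝓡 m) p ∘ γ) (coordRep Y p (extChartAt (𝓡 m) p (γ t))) t := by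
  rw [coordRep_extChartAt hp]
  have h1 := ((contMDiffAt_extChartAt' (I := 𝓡 m) (n := ∞)
    (by simpa using hp)).mdifferentiableAt (by simp)).hasMFDerivAt.comp t hγ
  refine HasFDerivAt.congr_fderiv h1.hasFDerivAt ?_
  refine ContinuousLinearMap.ext_ring ?_
  change mfderiv (𝓡 m) 𝓘(ℝ, EuclideanSpace ℝ (Fin m)) (extChartAt (𝓡 m) p) (γ t)
    ((1 : ℝ) • Y (γ t)) = (1 : ℝ) • _
  rw [one_smul, one_smul]

end Charts

/-! ### Order of a vector field on a manifold -/

theorem vectorFieldOrder_eq_top_iff {m : ℕ} {M : Type*} [TopologicalSpace M]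
    [ChartedSpace (EuclideanSpace ℝ (Fin m)) M] {X : (x : M) → TangentSpace (𝓡 m) x} {p : M} :
    vectorFieldOrder X p = ⊤ ↔ ∀ n, JetVanishes X n p := by
  simp [vectorFieldOrder, iInf_eq_top]

section Order

variable {m : ℕ} {M : Type*} [TopologicalSpace M] [ChartedSpace (EuclideanSpace ℝ (Fin m)) M]
  [IsManifold (𝓡 m) ∞ M] {X Y : (x : M) → TangentSpace (𝓡 m) x} {p q x : M} {n : ℕ}

theorem contDiffAt_extChartAt_comp_symm (hp : x ∈ (extChartAt (𝓡 m) p).source)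
    (hq : x ∈ (extChartAt (𝓡 m) q).source) :
    ContDiffAt ℝ ∞ (extChartAt (𝓡 m) q ∘ (extChartAt (𝓡 m) p).symm) (extChartAt (𝓡 m) p x) := by
  have hq' : (extChartAt (𝓡 m) p).symm (extChartAt (𝓡 m) p x) ∈
      (chartAt (EuclideanSpace ℝ (Fin m)) q).source := by
    rw [(extChartAt (𝓡 m) p).left_inv hp]; simpa using hq
  exact ((contMDiffAt_extChartAt' hq').comp _ (contMDiffAt_extChartAt_symm_of_mem_target
    ((extChartAt (𝓡 m) p).map_source hp))).contDiffAt

/-- The order of vanishing of a vector field at `x`, in the growth sense, can be read off in any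
chart around `x`. -/
theorem isBigO_coordRep_change_chart (hp : x ∈ (extChartAt (𝓡 m) p).source)
    (hq : x ∈ (extChartAt (𝓡 m) q).source)
    (hO : coordRep X p =O[𝓝 (extChartAt (𝓡 m) p x)] fun y => ‖y - extChartAt (𝓡 m) p x‖ ^ n) :
    coordRep X q =O[𝓝 (extChartAt (𝓡 m) q x)] fun y => ‖y - extChartAt (𝓡 m) q x‖ ^ n := by
  set y₀ := extChartAt (𝓡 m) q x with hy₀
  set τ := extChartAt (𝓡 m) p ∘ (extChartAt (𝓡 m) q).symm with hτ
  have hy₀t : y₀ ∈ (extChartAt (𝓡 m) q).target := (extChartAt (𝓡 m) q).map_source hq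
  have hsymm₀ : (extChartAt (𝓡 m) q).symm y₀ = x := (extChartAt (𝓡 m) q).left_inv hq
  have hτ₀ : τ y₀ = extChartAt (𝓡 m) p x := by simp only [hτ, Function.comp_apply, hsymm₀]
  have hτs : ContDiffAt ℝ ∞ τ y₀ := contDiffAt_extChartAt_comp_symm hq hp
  have hτt : Tendsto τ (𝓝 y₀) (𝓝 (extChartAt (𝓡 m) p x)) := hτ₀ ▸ hτs.continuousAt.tendsto
  have hD : (fun z => fderiv ℝ (extChartAt (𝓡 m) q ∘ (extChartAt (𝓡 m) p).symm) (τ z)) =O[𝓝 y₀]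
      fun _ => (1 : ℝ) :=
    (((contDiffAt_extChartAt_comp_symm hp hq).fderiv_right (m := 0)
      (by simp)).continuousAt.tendsto.comp hτt).isBigO_one ℝ
  have h1 : (fun z => coordRep X p (τ z)) =O[𝓝 y₀] fun z => ‖z - y₀‖ ^ n := by
    refine (hO.comp_tendsto hτt).trans ?_
    have := (hτs.differentiableAt (by simp)).isBigO_sub.norm_norm.pow n
    simpa [Function.comp_def, hτ₀] using this
  have h2 : coordRep X q =O[𝓝 y₀] fun z =>
      ‖fderiv ℝ (extChartAt (𝓡 m) q ∘ (extChartAt (𝓡 m) p).symm) (τ z)‖ *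
        ‖coordRep X p (τ z)‖ := by
    refine IsBigO.of_bound 1 ?_
    have hnear : ∀ᶠ z in 𝓝 y₀, (extChartAt (𝓡 m) q).symm z ∈ (extChartAt (𝓡 m) p).source := by
      have : ContinuousAt (extChartAt (𝓡 m) q).symm y₀ := continuousAt_extChartAt_symm'' hy₀t
      refine this.eventually_mem ?_
      rw [hsymm₀]
      exact (isOpen_extChartAt_source p).mem_nhds hp
    filter_upwards [(isOpen_extChartAt_target q).mem_nhds hy₀t, hnear] with z hz hzp
    have h := coordRep_change_chart (X := X) hzp ((extChartAt (𝓡 m) q).map_target hz)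
    rw [(extChartAt (𝓡 m) q).right_inv hz] at h
    rw [h, one_mul, norm_mul, norm_norm, norm_norm]
    exact ContinuousLinearMap.le_opNorm _ _
  refine h2.trans ?_
  simpa using hD.norm_left.mul h1.norm_left

theorem IsSmoothVectorField.contDiffAt_coordRep (hX : IsSmoothVectorField X)
    (hx : x ∈ (extChartAt (𝓡 m) p).source) :
    ContDiffAt ℝ ∞ (coordRep X p) (extChartAt (𝓡 m) p x) :=
  (hX.contDiffOn_coordRep p).contDiffAt
    ((isOpen_extChartAt_target p).mem_nhds ((extChartAt (𝓡 m) p).map_source hx))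

/-- `JetVanishes X n x`, defined through the chart at `x`, expressed in the chart at any `p` whose
domain contains `x`. -/
theorem IsSmoothVectorField.jetVanishes_iff_isBigO (hX : IsSmoothVectorField X)
    (hx : x ∈ (extChartAt (𝓡 m) p).source) :
    JetVanishes X n x ↔ coordRep X p =O[𝓝 (extChartAt (𝓡 m) p x)]
      fun y => ‖y - extChartAt (𝓡 m) p x‖ ^ (n + 1) := by
  have hxx := mem_extChartAt_source (I := 𝓡 m) x
  rw [JetVanishes, ((hX.contDiffAt_coordRep hxx).of_le
    (by exact_mod_cast le_top)).iteratedFDeriv_eq_zero_iff_isBigO]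
  exact ⟨isBigO_coordRep_change_chart hxx hx, isBigO_coordRep_change_chart hx hxx⟩

theorem mem_zeroSet_iff_jetVanishes : p ∈ zeroSet X ↔ JetVanishes X 0 p := by
  have h : X p = 0 ↔ coordRep X p (extChartAt (𝓡 m) p p) = 0 :=
    (coordRep_eq_zero_iff (mem_extChartAt_source p)).symm
  change X p = 0 ↔ _
  simp only [JetVanishes, Nat.le_zero, forall_eq, h]
  rw [← norm_eq_zero, ← norm_iteratedFDeriv_zero (𝕜 := ℝ), norm_eq_zero]

/-- The jets of `X` that vanish are locally the same along an integral curve of `Y`, because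
`‖DX Y‖ = ‖DY X + f X‖ ≤ (‖DY‖ + |f|) ‖X‖` in a chart. -/
theorem eventually_jetVanishes_iff_of_isMIntegralCurveAt {f : M → ℝ} (hX : IsSmoothVectorField X)
    (hY : IsSmoothVectorField Y) (hf : IsTrackingFunction Y X f) {γ : ℝ → M} {t₀ : ℝ}
    (hγ : IsMIntegralCurveAt γ Y t₀) :
    ∀ᶠ t in 𝓝 t₀, ∀ n, JetVanishes X n (γ t) ↔ JetVanishes X n (γ t₀) := by
  set p := γ t₀ with hp
  have hps := mem_extChartAt_source (I := 𝓡 m) p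
  have hpt := mem_extChartAt_target (I := 𝓡 m) p
  set y₀ := extChartAt (𝓡 m) p p with hy₀
  have hXs := hX.contDiffAt_coordRep hps
  have hYs := hY.contDiffAt_coordRep hps
  have hsrc : ∀ᶠ t in 𝓝 t₀, γ t ∈ (extChartAt (𝓡 m) p).source :=
    hγ.continuousAt.eventually_mem ((isOpen_extChartAt_source p).mem_nhds hps)
  have hfc : ContinuousAt (fun y => |f ((extChartAt (𝓡 m) p).symm y)| +
      ‖fderiv ℝ (coordRep Y p) y‖) y₀ :=
    ((hf.1.continuousAt.comp (continuousAt_extChartAt_symm'' hpt)).abs).add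
      (hYs.fderiv_right (m := 0) (by simp)).continuousAt.norm
  have key := eventually_isBigO_pow_iff_of_integralCurve (V := coordRep Y p) (X := coordRep X p)
    (c := extChartAt (𝓡 m) p ∘ γ) (t₀ := t₀)
    (K := |f ((extChartAt (𝓡 m) p).symm y₀)| + ‖fderiv ℝ (coordRep Y p) y₀‖ + 1) (by positivity)
    (hYs.of_le (by simp))
    (by
      filter_upwards [(isOpen_extChartAt_target p).mem_nhds hpt] with y hy
      exact ((hX.contDiffOn_coordRep p).contDiffAt
        ((isOpen_extChartAt_target p).mem_nhds hy)).differentiableAt (by simp))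
    (by
      filter_upwards [(isOpen_extChartAt_target p).mem_nhds hpt,
        hfc.eventually_lt_const (lt_add_one _)] with y hy hyK
      rw [sub_eq_iff_eq_add.1 (coordRep_lieBracket hX hY hf hy)]
      calc _ ≤ |f ((extChartAt (𝓡 m) p).symm y)| * ‖coordRep X p y‖ +
            ‖fderiv ℝ (coordRep Y p) y‖ * ‖coordRep X p y‖ := by
            refine (norm_add_le _ _).trans ?_
            gcongr
            · rw [norm_smul, Real.norm_eq_abs]
            · exact ContinuousLinearMap.le_opNorm _ _
        _ = (|f ((extChartAt (𝓡 m) p).symm y)| + ‖fderiv ℝ (coordRep Y p) y‖) *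
            ‖coordRep X p y‖ := by ring
        _ ≤ _ := by gcongr)
    (by
      filter_upwards [hγ, hsrc] with t ht hts
      exact hasDerivAt_extChartAt_comp_integralCurve ht hts)
  filter_upwards [key, hsrc] with t ht hts n
  rw [hX.jetVanishes_iff_isBigO hts, hX.jetVanishes_iff_isBigO hps]
  exact ht (n + 1)

theorem jetVanishes_iff_of_mem_orbitOf {f : M → ℝ} (hX : IsSmoothVectorField X)
    (hY : IsSmoothVectorField Y) (hf : IsTrackingFunction Y X f) (hq : q ∈ orbitOf Y p) (n : ℕ) :
    JetVanishes X n q ↔ JetVanishes X n p := by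
  obtain ⟨γ, J, hJo, hJc, h0, hγ, rfl, t, ht, rfl⟩ := hq
  have := hJc.isPreconnected.induction₂
    (fun s t => JetVanishes X n (γ t) ↔ JetVanishes X n (γ s))
    (fun s hs => (eventually_jetVanishes_iff_of_isMIntegralCurveAt hX hY hf
      (hγ.isMIntegralCurveAt (hJo.mem_nhds hs))).filter_mono nhdsWithin_le_nhds |>.mono
      fun t h => h n)
    (fun _ _ _ _ _ _ h₁ h₂ => h₂.trans h₁) (fun _ _ _ _ h => h.symm) h0 ht
  exact this

theorem eventually_not_jetVanishes (hX : IsSmoothVectorField X) (hp : ¬ JetVanishes X n p) :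
    ∀ᶠ x in 𝓝 p, ¬ JetVanishes X n x := by
  simp only [JetVanishes, not_forall] at hp
  obtain ⟨k, hk, hne⟩ := hp
  have hps := mem_extChartAt_source (I := 𝓡 m) p
  have hc : ContinuousAt (fun x => iteratedFDeriv ℝ k (coordRep X p) (extChartAt (𝓡 m) p x)) p :=
    ContinuousAt.comp (f := extChartAt (𝓡 m) p)
      ((hX.contDiffAt_coordRep hps).continuousAt_iteratedFDeriv (by exact_mod_cast le_top))
      (continuousAt_extChartAt p)
  filter_upwards [hc.eventually_ne hne, (isOpen_extChartAt_source p).mem_nhds hps] with x hx hxs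
  rw [hX.jetVanishes_iff_isBigO hxs, ← ((hX.contDiffAt_coordRep hxs).of_le
    (by exact_mod_cast le_top)).iteratedFDeriv_eq_zero_iff_isBigO]
  exact fun h => hx (h k hk)

theorem eventually_ne_zero (hX : IsSmoothVectorField X) (hp : X p ≠ 0) :
    ∀ᶠ x in 𝓝 p, X x ≠ 0 := by
  have h : ∀ x, X x ≠ 0 ↔ ¬ JetVanishes X 0 x := fun x => not_congr mem_zeroSet_iff_jetVanishes
  simpa only [h] using eventually_not_jetVanishes hX ((h p).1 hp)

end Order

/-! ### Regularity of the tracking function on a surface -/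

theorem contMDiffAt_of_contDiffAt_comp_extChartAt_symm {m : ℕ} {M : Type*} [TopologicalSpace M]
    [ChartedSpace (EuclideanSpace ℝ (Fin m)) M] {f : M → ℝ} {p : M}
    (h : ContDiffAt ℝ ∞ (f ∘ (extChartAt (𝓡 m) p).symm) (extChartAt (𝓡 m) p p)) :
    ContMDiffAt (𝓡 m) 𝓘(ℝ, ℝ) ∞ f p := by
  refine (h.contMDiffAt.comp p (contMDiffAt_extChartAt (n := ∞))).congr_of_eventuallyEq ?_
  filter_upwards [(isOpen_extChartAt_source p).mem_nhds (mem_extChartAt_source (I := 𝓡 m) p)]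
    with x hx
  exact congrArg f ((extChartAt (𝓡 m) p).left_inv hx).symm

section Tracking

variable {m : ℕ} {M : Type*} [TopologicalSpace M] [ChartedSpace (EuclideanSpace ℝ (Fin m)) M]
  [IsManifold (𝓡 m) ∞ M] {X Y : (x : M) → TangentSpace (𝓡 m) x} {f : M → ℝ} {p : M}

theorem IsTrackingFunction.contMDiffAt_of_ne_zero (hX : IsSmoothVectorField X)
    (hY : IsSmoothVectorField Y) (hf : IsTrackingFunction Y X f) (hp : X p ≠ 0) :
    ContMDiffAt (𝓡 m) 𝓘(ℝ, ℝ) ∞ f p := by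
  have hps := mem_extChartAt_source (I := 𝓡 m) p
  have hXs := hX.contDiffAt_coordRep hps
  have hYs := hY.contDiffAt_coordRep hps
  refine contMDiffAt_of_contDiffAt_comp_extChartAt_symm (contDiffAt_of_eventually_eq_smul
    (((hXs.fderiv_right (m := ∞) (by simp)).clm_apply hYs).sub
      ((hYs.fderiv_right (m := ∞) (by simp)).clm_apply hXs)) hXs
    ((coordRep_eq_zero_iff hps).not.2 hp) ?_)
  filter_upwards [(isOpen_extChartAt_target p).mem_nhds (mem_extChartAt_target (I := 𝓡 m) p)]
    with y hy
  exact coordRep_lieBracket hX hY hf hy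

end Tracking

/-- The two coordinates of the plane can be ordered so that the first one does not vanish on a
given non-zero vector. -/
theorem EuclideanSpace.exists_adapted_coordinates {v : EuclideanSpace ℝ (Fin 2)} (hv : v ≠ 0) :
    ∃ (lam mu : EuclideanSpace ℝ (Fin 2) →L[ℝ] ℝ) (w : EuclideanSpace ℝ (Fin 2)),
      lam w = 0 ∧ mu w = 1 ∧ (∀ x, lam x = 0 → x = mu x • w) ∧ lam v ≠ 0 := by
  have hij : ∃ i j : Fin 2, i ≠ j ∧ v i ≠ 0 := by
    by_contra! h
    refine hv (PiLp.ext fun i => ?_)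
    fin_cases i
    · exact h 0 1 (by decide)
    · exact h 1 0 (by decide)
  obtain ⟨i, j, hij, hvi⟩ := hij
  refine ⟨EuclideanSpace.proj i, EuclideanSpace.proj j, EuclideanSpace.single j 1, ?_, ?_, ?_, hvi⟩
  · simp [hij]
  · simp
  · intro x hx
    refine PiLp.ext fun k => ?_
    rcases eq_or_ne k j with rfl | hk
    · simp
    · have : k = i := by omega
      subst this
      simpa [hk] using hx

/-- Regularity of the tracking function at a point where `X` has finite order and `Y` does not
vanish. Dimension two enters here: an integral curve of `Y` is a hypersurface. -/
theorem IsTrackingFunction.contMDiffAt_of_finite_order {M : Type*} [TopologicalSpace M]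
    [ChartedSpace (EuclideanSpace ℝ (Fin 2)) M] [IsManifold (𝓡 2) ∞ M]
    {X Y : (x : M) → TangentSpace (𝓡 2) x} {f : M → ℝ} {p : M} (hX : IsSmoothVectorField X)
    (hY : IsSmoothVectorField Y) (hf : IsTrackingFunction Y X f) {n : ℕ}
    (hn : ¬ JetVanishes X n p) (hYp : Y p ≠ 0) :
    ContMDiffAt (𝓡 2) 𝓘(ℝ, ℝ) ∞ f p := by
  classical
  have hps := mem_extChartAt_source (I := 𝓡 2) p
  have hpt := mem_extChartAt_target (I := 𝓡 2) p
  have htarget := (isOpen_extChartAt_target (I := 𝓡 2) p).mem_nhds hpt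
  -- `k` is the order of `X` at `p`
  obtain ⟨k, hk, hmin⟩ : ∃ k, ¬ JetVanishes X k p ∧ ∀ j < k, JetVanishes X j p :=
    have h : ∃ k, ¬ JetVanishes X k p := ⟨n, hn⟩
    ⟨Nat.find h, Nat.find_spec h, fun j hj => not_not.1 (Nat.find_min h hj)⟩
  have hO : coordRep X p =O[𝓝 (extChartAt (𝓡 2) p p)]
      fun y => ‖y - extChartAt (𝓡 2) p p‖ ^ k := by
    rcases k with _ | k
    · simpa using (hX.contDiffAt_coordRep hps).continuousAt.tendsto.isBigO_one ℝ
    · exact (hX.jetVanishes_iff_isBigO hps).1 (hmin k k.lt_succ_self)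
  rw [hX.jetVanishes_iff_isBigO hps] at hk
  -- only germs matter, so the coordinate expressions may be replaced by globally smooth maps
  obtain ⟨X', hX', hXX'⟩ := (hX.contDiffOn_coordRep p).exists_contDiff_eventuallyEq htarget
  obtain ⟨Y', hY', hYY'⟩ := (hY.contDiffOn_coordRep p).exists_contDiff_eventuallyEq htarget
  have hY0 : Y' (extChartAt (𝓡 2) p p) ≠ 0 := by
    rw [hYY'.self_of_nhds]
    exact (coordRep_eq_zero_iff hps).not.2 hYp
  obtain ⟨lam, mu, w, hlw, hmw, hker, hlY⟩ := EuclideanSpace.exists_adapted_coordinates hY0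
  refine contMDiffAt_of_contDiffAt_comp_extChartAt_symm
    (contDiffAt_of_bracket_eq_smul_of_finite_order hX' hY' ?_ ?_ hlw hmw hker hlY
      (hO.congr' hXX'.symm EventuallyEq.rfl)
      fun h => hk (h.congr' hXX' EventuallyEq.rfl))
  · filter_upwards [htarget] with y hy
    exact hf.1.continuousAt.comp (continuousAt_extChartAt_symm'' hy)
  · filter_upwards [hXX'.eventuallyEq_nhds, hYY'.eventuallyEq_nhds, htarget] with y hXy hYy hy
    rw [hXy.fderiv_eq, hYy.fderiv_eq, hXy.self_of_nhds, hYy.self_of_nhds]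
    exact coordRep_lieBracket hX hY hf hy

theorem proposition1 {M : Type*} [TopologicalSpace M] [T2Space M]
    [ChartedSpace (EuclideanSpace ℝ (Fin 2)) M] [IsManifold (𝓡 2) ∞ M]
    (X Y : (x : M) → TangentSpace (𝓡 2) x)
    (hX : IsSmoothVectorField X) (hY : IsSmoothVectorField Y)
    (f : M → ℝ) (hf : IsTrackingFunction Y X f) :
    (∀ n : ℕ∞, 1 ≤ n → IsInvariantUnder Y (zerosOfOrder X n)) ∧
    IsOpen ((zeroSet X)ᶜ ∪ ((zeroSet X \ zerosOfOrder X ⊤) ∩ (zeroSet Y)ᶜ)) ∧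
    ContMDiffOn (𝓡 2) 𝓘(ℝ, ℝ) ∞ f
      ((zeroSet X)ᶜ ∪ ((zeroSet X \ zerosOfOrder X ⊤) ∩ (zeroSet Y)ᶜ)) := by
  have hmem : ∀ p, p ∈ (zeroSet X)ᶜ ∪ ((zeroSet X \ zerosOfOrder X ⊤) ∩ (zeroSet Y)ᶜ) ↔
      X p ≠ 0 ∨ (∃ n, ¬ JetVanishes X n p) ∧ Y p ≠ 0 := by
    intro p
    have h1 : p ∈ zerosOfOrder X ⊤ ↔ X p = 0 ∧ ∀ n, JetVanishes X n p :=
      and_congr Iff.rfl vectorFieldOrder_eq_top_iff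
    have h2 : p ∈ zeroSet X ↔ X p = 0 := Iff.rfl
    have h3 : p ∈ zeroSet Y ↔ Y p = 0 := Iff.rfl
    simp only [Set.mem_union, Set.mem_compl_iff, Set.mem_inter_iff, Set.mem_sdiff, h1, h2, h3,
      ← not_forall]
    tauto
  refine ⟨fun n _ p hp q hq => ?_, isOpen_iff_mem_nhds.2 fun p hp => ?_, fun p hp => ?_⟩
  · have hjet := jetVanishes_iff_of_mem_orbitOf hX hY hf hq
    refine ⟨?_, ?_⟩
    · rw [mem_zeroSet_iff_jetVanishes, hjet, ← mem_zeroSet_iff_jetVanishes]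
      exact hp.1
    · rw [← hp.2]
      simp only [vectorFieldOrder, hjet]
  · refine eventually_mem_set.1 ?_
    simp only [hmem] at hp ⊢
    rcases hp with hp | ⟨⟨n, hn⟩, hYp⟩
    · exact (eventually_ne_zero hX hp).mono fun x hx => Or.inl hx
    · filter_upwards [eventually_not_jetVanishes hX hn, eventually_ne_zero hY hYp] with x hx hYx
      exact Or.inr ⟨⟨n, hx⟩, hYx⟩
  · refine ContMDiffAt.contMDiffWithinAt ?_
    rcases (hmem p).1 hp with hp | ⟨⟨n, hn⟩, hYp⟩
    · exact hf.contMDiffAt_of_ne_zero hX hY hp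
    · exact hf.contMDiffAt_of_finite_order hX hY hn hYp
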